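/- Let $\mathcal M=(M,<,P_i,E_j,R_{n,j})_{i\in I,\,j\in J,\,n\in\mathbb Z}$ be a structure in which $<$ is a linear order on $M$, each $P_i$ is a subset of $M$, and each $E_j$ is a convex equivalence relation on $M$ (an equivalence relation with $<$-convex classes). Suppose that every subset of $M$ that is definable without parameters in $\mathcal M$ is one of the $P_i$, and that every convex equivalence relation on $M$ that is definable without parameters in $\mathcal M$ is one of the $E_j$. For a convex equivalence relation $E$, $y\in M$ and $n\in\mathbb Z$ let $S^n_E(y)$ be the $n$-th consecutive $E$-class succeeding the class $[y]_E$ if $n>0$, the class $[y]_E$ itself if $n=0$, and the $|n|$-th consecutive $E$-class preceding $[y]_E$ if $n<0$; put $S^n_E(y)=\emptyset$ if no such class exists. Write $x<S^n_E(y)$ if $S^n_E(y)\neq\emptyset$ and $x<z$ for all $z\in S^n_E(y)$, and write $x\leqslant S^n_E(y)$ if $x<S^n_E(y)$ or $x\in S^n_E(y)$. Suppose that for all $j\in J$ and $n\in\mathbb Z$ the binary relation $R_{n,j}(x,y)$ is $x\leqslant S^n_{E_j}(y)$ if $n\geqslant 0$ and $x<S^n_{E_j}(y)$ if $n<0$.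 Then the complete first-order theory of $\mathcal M$ eliminates quantifiers: every formula is equivalent modulo it to a quantifier-free formula in the same free variables. -/

import Mathlib

open FirstOrder

/-- A convex equivalence relation on a linear order: an equivalence relation all of whose classes
are convex. -/
structure IsConvexEquiv {M : Type*} [LinearOrder M] (r : M → M → Prop) : Prop where
  equivalence : Equivalence r
  convex : ∀ x, Set.OrdConnected {y | r x y}

section Successors

variable {M : Type*} [LinearOrder M]

/-- For a convex equivalence relation `r`: the class of `y` is the immediate successor of the
class of `x`. -/
def NextClass (r : M → M → Prop) (x y : M) : Prop :=
  x < y ∧ ¬ r x y ∧ ∀ z, x < z → z < y → r x z ∨ r z y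

/-- The `n`-th consecutive `r`-class succeeding the class of `x` exists and contains `y`
(for `n = 0`: `y` is in the class of `x`). -/
def SuccClassNat (r : M → M → Prop) : ℕ → M → M → Prop
  | 0, x, y => r x y
  | n + 1, x, y => ∃ z, SuccClassNat r n x z ∧ NextClass r z y

/-- `S^N_r(x, y)` for an integer `N`; for `N < 0` it is `S^{-N}_r(y, x)`. -/
def SuccClass (r : M → M → Prop) (N : ℤ) (x y : M) : Prop :=
  if 0 ≤ N then SuccClassNat r N.toNat x y else SuccClassNat r (-N).toNat y x

/-- `x < S^N_r(y)`: the class `S^N_r(y)` exists and all its elements are above `x`. -/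
def LtSucc (r : M → M → Prop) (N : ℤ) (x y : M) : Prop :=
  (∃ z, SuccClass r N y z) ∧ ∀ z, SuccClass r N y z → x < z

/-- `x ≤ S^N_r(y)`: either `x < S^N_r(y)` or `x` belongs to the class `S^N_r(y)`. -/
def LeSucc (r : M → M → Prop) (N : ℤ) (x y : M) : Prop :=
  LtSucc r N x y ∨ SuccClass r N y x

end Successors

/-- The relation symbols `<`, `P_i` (unary), `E_j` (binary) and `R_{n,j}` (binary, `n ∈ ℤ`). -/
inductive CcelSuccRel (I : Type*) (J : Type*) : ℕ → Type _
  | lt : CcelSuccRel I J 2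
  | P (i : I) : CcelSuccRel I J 1
  | E (j : J) : CcelSuccRel I J 2
  | R (n : ℤ) (j : J) : CcelSuccRel I J 2

/-- The relational language `{<} ∪ {P_i} ∪ {E_j} ∪ {R_{n,j}}`. -/
def ccelSuccLanguage (I : Type*) (J : Type*) : Language where
  Functions := fun _ => Empty
  Relations := CcelSuccRel I J

/-- The interpretation of the symbol `<`. -/
def ltInterp (I J M : Type*) [(ccelSuccLanguage I J).Structure M] (x y : M) : Prop :=
  Language.Structure.RelMap (L := ccelSuccLanguage I J) CcelSuccRel.lt ![x, y]

/-- The interpretation of the symbol `P_i`. -/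
def PInterp {I : Type*} (J M : Type*) [(ccelSuccLanguage I J).Structure M] (i : I) : Set M :=
  {x | Language.Structure.RelMap (L := ccelSuccLanguage I J) (CcelSuccRel.P i) ![x]}

/-- The interpretation of the symbol `E_j`. -/
def EInterp (I : Type*) {J : Type*} (M : Type*) [(ccelSuccLanguage I J).Structure M] (j : J)
    (x y : M) : Prop :=
  Language.Structure.RelMap (L := ccelSuccLanguage I J) (CcelSuccRel.E j) ![x, y]

/-- The interpretation of the symbol `R_{n,j}`. -/
def RInterp (I : Type*) {J : Type*} (M : Type*) [(ccelSuccLanguage I J).Structure M] (n : ℤ)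
    (j : J) (x y : M) : Prop :=
  Language.Structure.RelMap (L := ccelSuccLanguage I J) (CcelSuccRel.R n j) ![x, y]

/-- `(M, <, P_i, E_j, R_{n,j})` is a linearly ordered structure in which the `E_j` are convex
equivalence relations, all unary sets and all convex equivalence relations that are definable
without parameters in the structure are named by the `P_i` and the `E_j`, and `R_{n,j}` is
`x ≤ S^n_{E_j}(y)` for `n ≥ 0` and `x < S^n_{E_j}(y)` for `n < 0`. -/
structure IsNamedCcelSucc (I J : Type*) (M : Type*) [LinearOrder M]
    [(ccelSuccLanguage I J).Structure M] : Prop where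
  lt_iff : ∀ x y : M, ltInterp I J M x y ↔ x < y
  isConvexEquiv : ∀ j : J, IsConvexEquiv (EInterp I M j)
  R_nonneg : ∀ (n : ℤ) (j : J), 0 ≤ n →
    ∀ x y : M, RInterp I M n j x y ↔ LeSucc (EInterp I M j) n x y
  R_neg : ∀ (n : ℤ) (j : J), n < 0 →
    ∀ x y : M, RInterp I M n j x y ↔ LtSucc (EInterp I M j) n x y
  named_unary : ∀ s : Set M, (∅ : Set M).Definable₁ (ccelSuccLanguage I J) s →
    ∃ i : I, PInterp J M i = s
  named_convexEquiv : ∀ r : M → M → Prop, IsConvexEquiv r →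
    (∅ : Set M).Definable₂ (ccelSuccLanguage I J) {p : M × M | r p.1 p.2} →
    ∃ j : J, EInterp I M j = r

/-- A theory eliminates quantifiers: modulo the theory, every formula in finitely many free
variables is equivalent to a quantifier-free formula in the same free variables. -/
def EliminatesQuantifiers {L : Language} (T : L.Theory) : Prop :=
  ∀ (n : ℕ) (φ : L.Formula (Fin n)), ∃ ψ : L.Formula (Fin n), ψ.IsQF ∧ T.Iff φ ψ

/-! Write a monotone binary relation as a map `A` from points to initial segments. Call it local
when boundedly many jumps of `A` force it to behave like `≤`. Definable local relations are closed
under converses of complements and under the residuals `P ∩ B y ⊆ A x`. Lower sets form a chain, so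
`∃ z ∈ P` subject to membership in some segments and non-membership in others says that certain
residuals fail. Hence the boolean combinations of unary conditions and definable local relations are
closed under quantifiers, and every formula is one of them.

It remains to express a reflexive definable local relation `F` without quantifiers. The kernel of
`F` is a definable convex equivalence relation, hence named. By locality `F x` reaches only
boundedly many of its classes beyond that of `x`. Which class is the last one is a definable, hence
named, unary condition on `x`, and once it is the `n`-th, `y ∈ F x` is given by the symbol `R_n` of
the kernel. An arbitrary local relation is recovered from reflexive ones by comparing its
arguments. -/

namespace IsConvexEquiv

variable {M : Type*} [LinearOrder M] {r : M → M → Prop} (hr : IsConvexEquiv r) {n : ℕ}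
  {x z z' : M}

include hr

theorem rel_of_nextClass_of_lt {w w' : M} (hww : r w w') (h : NextClass r w z)
    (h' : NextClass r w' z') (hzz : z < z') : r z z' := by
  rcases lt_or_ge w' z with hwz | hzw
  · exact (h'.2.2 z hwz hzz).resolve_left fun hr' => h.2.1 (hr.equivalence.trans hww hr')
  · exact absurd ((hr.convex w).out (hr.equivalence.refl w) hww ⟨h.1.le, hzw⟩) h.2.1

theorem rel_of_succClassNat (hz : SuccClassNat r n x z) (hz' : SuccClassNat r n x z') :
    r z z' := by
  induction n generalizing z z' with
  | zero => exact hr.equivalence.trans (hr.equivalence.symm hz) hz'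
  | succ n ih =>
    obtain ⟨w, hw, hwz⟩ := hz
    obtain ⟨w', hw', hwz'⟩ := hz'
    have hww : r w w' := ih hw hw'
    rcases lt_trichotomy z z' with hlt | rfl | hgt
    · exact hr.rel_of_nextClass_of_lt hww hwz hwz' hlt
    · exact hr.equivalence.refl _
    · exact hr.equivalence.symm
        (hr.rel_of_nextClass_of_lt (hr.equivalence.symm hww) hwz' hwz hgt)

theorem lt_of_lt_of_not_rel (hxz : x < z) (hrxz : ¬ r x z) (hzz : r z z') : x < z' := by
  refine lt_of_not_ge fun hle => hrxz (hr.equivalence.symm ?_)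
  exact (hr.convex z).out hzz (hr.equivalence.refl z) ⟨hle, hxz.le⟩

theorem nextClass_of_rel (h : NextClass r x z) (hzz : r z z') : NextClass r x z' := by
  obtain ⟨hxz, hrxz, hbetween⟩ := h
  refine ⟨hr.lt_of_lt_of_not_rel hxz hrxz hzz,
    fun hxz' => hrxz (hr.equivalence.trans hxz' (hr.equivalence.symm hzz)), fun u hxu huz' => ?_⟩
  rcases lt_or_ge u z with huz | hzu
  · exact (hbetween u hxu huz).imp_right fun huz => hr.equivalence.trans huz hzz
  · have hru : r z u := (hr.convex z).out (hr.equivalence.refl z) hzz ⟨hzu, huz'.le⟩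
    exact Or.inr (hr.equivalence.trans (hr.equivalence.symm hru) hzz)

theorem succClassNat_of_rel (h : SuccClassNat r n x z) (hzz : r z z') :
    SuccClassNat r n x z' := by
  cases n with
  | zero => exact hr.equivalence.trans h hzz
  | succ n =>
    obtain ⟨w, hw, hwz⟩ := h
    exact ⟨w, hw, hr.nextClass_of_rel hwz hzz⟩

end IsConvexEquiv

namespace CcelSucc

open Set

section Jumps

variable {M α β : Type*}

section Preorder

variable [Preorder M] [Preorder α] {A : M → α} {m n : ℕ} {x z : M}

/-- At least `n` strict increases of `A` occur on the way from `x` up to `z`. -/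
def Jumps (A : M → α) : ℕ → M → M → Prop
  | 0, x, z => x ≤ z
  | n + 1, x, z => ∃ w, Jumps A n x w ∧ A w < A z

theorem Jumps.map [Preorder β] {B : M → β} (h : ∀ a b, A a < A b → B a < B b)
    (hA : Jumps A n x z) : Jumps B n x z := by
  induction n generalizing z with
  | zero => exact hA
  | succ n ih =>
    obtain ⟨w, hw, hwz⟩ := hA
    exact ⟨w, ih hw, h w z hwz⟩

theorem Jumps.exists_of_add (h : Jumps A (m + n) x z) : ∃ w, Jumps A m x w ∧ Jumps A n w z := by
  induction n generalizing z with
  | zero => exact ⟨z, h, le_refl z⟩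
  | succ n ih =>
    obtain ⟨u, hu, huz⟩ := h
    obtain ⟨w, hxw, hwu⟩ := ih hu
    exact ⟨w, hxw, u, hwu, huz⟩

theorem Jumps.trans_le (hA : Monotone A) {w : M} (h : Jumps A n x w) (hwz : w ≤ z) :
    Jumps A n x z := by
  cases n with
  | zero => exact le_trans h hwz
  | succ n =>
    obtain ⟨u, hu, huw⟩ := h
    exact ⟨u, hu, huw.trans_le (hA hwz)⟩

end Preorder

section LinearOrder

variable [LinearOrder M] [Preorder α] {A : M → α} {n : ℕ} {x z : M}

theorem Jumps.of_succ (hA : Monotone A) (h : Jumps A (n + 1) x z) : Jumps A n x z := by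
  obtain ⟨w, hw, hwz⟩ := h
  exact hw.trans_le hA (hA.reflect_lt hwz).le

theorem Jumps.of_le (hA : Monotone A) {m : ℕ} (h : Jumps A n x z) (hmn : m ≤ n) :
    Jumps A m x z := by
  induction n, hmn using Nat.le_induction with
  | base => exact h
  | succ n _ ih => exact ih (h.of_succ hA)

theorem Jumps.le (hA : Monotone A) (h : Jumps A n x z) : x ≤ z :=
  h.of_le hA n.zero_le

theorem Jumps.lt (hA : Monotone A) (h : Jumps A (n + 1) x z) : x < z := by
  obtain ⟨w, hw, hwz⟩ := h
  exact (hw.le hA).trans_lt (hA.reflect_lt hwz)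

theorem Jumps.exists_add_eq_of_prod [Preorder β] {f : M →o α} {g : M →o β}
    (h : Jumps (f.prod g) n x z) :
    ∃ k l, k + l = n ∧ Jumps f k x z ∧ Jumps g l x z := by
  induction n generalizing z with
  | zero => exact ⟨0, 0, rfl, h, h⟩
  | succ n ih =>
    obtain ⟨w, hw, hwz⟩ := h
    obtain ⟨k, l, rfl, hk, hl⟩ := ih hw
    have hle : w ≤ z := ((f.prod g).monotone.reflect_lt hwz).le
    rcases Prod.lt_iff.1 hwz with ⟨hf, -⟩ | ⟨-, hg⟩
    · exact ⟨k + 1, l, by omega, ⟨w, hk, hf⟩, hl.trans_le g.monotone hle⟩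
    · exact ⟨k, l + 1, by omega, hk.trans_le f.monotone hle, ⟨w, hl, hg⟩⟩

end LinearOrder

end Jumps

section LocalRelations

variable {M : Type*} [LinearOrder M]

/-- A monotone relation, encoded by the initial segments `A x` of the points `z` related to `x`, is
local when it behaves like the order itself on points that are far apart, with distance measured by
the number of jumps of `A`. -/
def IsLocal (A : M →o LowerSet M) : Prop :=
  ∃ N, ∀ x z, Jumps A N x z → z ∉ A x ∧ x ∈ A z

theorem apply_lt_apply_iff {A : M →o LowerSet M} {x y : M} :
    A x < A y ↔ ∃ z ∈ A y, z ∉ A x := by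
  rw [← not_le, ← LowerSet.coe_subset_coe, not_subset]
  rfl

theorem lt_of_mem_of_notMem {S : LowerSet M} {x y : M} (hx : x ∈ S) (hy : y ∉ S) : x < y :=
  lt_of_not_ge fun h => hy (S.lower h hx)

/-- The converse of the complement of a monotone relation. -/
def dual (A : M →o LowerSet M) : M →o LowerSet M where
  toFun x := ⟨{z | x ∉ A z}, fun _ _ hle hz h => hz (A.monotone hle h)⟩
  monotone' _ _ hle _ hz h := hz ((A _).lower hle h)

@[simp]
theorem mem_dual {A : M →o LowerSet M} {x z : M} : z ∈ dual A x ↔ x ∉ A z :=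
  Iff.rfl

theorem Jumps.exists_of_dual {A : M →o LowerSet M} {n : ℕ} {x z : M}
    (h : Jumps (dual A) (n + 1) x z) : ∃ a b, Jumps A n a b ∧ x ∈ A a ∧ z ∉ A b := by
  induction n generalizing z with
  | zero =>
    obtain ⟨w, hxw, hwz⟩ := h
    obtain ⟨a, haz, haw⟩ := apply_lt_apply_iff.1 hwz
    exact ⟨a, a, le_refl a, (A a).lower hxw (not_not.1 haw), haz⟩
  | succ n ih =>
    obtain ⟨w, hxw, hwz⟩ := h
    obtain ⟨a, b, hab, hxa, hwb⟩ := ih hxw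
    obtain ⟨c, hcz, hcw⟩ := apply_lt_apply_iff.1 hwz
    exact ⟨a, c, ⟨b, hab, apply_lt_apply_iff.2 ⟨w, not_not.1 hcw, hwb⟩⟩, hxa, hcz⟩

protected theorem IsLocal.dual {A : M →o LowerSet M} (hA : IsLocal A) : IsLocal (dual A) := by
  obtain ⟨N, hN⟩ := hA
  refine ⟨N + 1, fun x z h => ?_⟩
  obtain ⟨a, b, hab, hxa, hzb⟩ := h.exists_of_dual
  obtain ⟨hba, hab⟩ := hN a b hab
  have haz : a < z := lt_of_mem_of_notMem hab hzb
  have hxb : x < b := lt_of_mem_of_notMem hxa hba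
  exact ⟨not_not.2 (A.monotone haz.le hxa), fun hzx => hzb (A.monotone hxb.le hzx)⟩

/-- The residual of `A` by `B` over `P`: the points `y` such that every element of `P` in the
segment `B y` lies in `A x`. -/
def residual (P : Set M) (A B : M →o LowerSet M) : M →o LowerSet M where
  toFun x := ⟨{y | P ∩ B y ⊆ A x}, fun _ _ hle hy =>
    (inter_subset_inter_right P (B.monotone hle)).trans hy⟩
  monotone' _ _ hle _ hy _ hp := A.monotone hle (hy hp)

section Residual

variable {P : Set M} {A B : M →o LowerSet M} {x z : M}

theorem mem_residual : z ∈ residual P A B x ↔ P ∩ B z ⊆ A x :=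
  Iff.rfl

theorem notMem_residual : z ∉ residual P A B x ↔ ∃ p ∈ P, p ∈ B z ∧ p ∉ A x := by
  simp only [mem_residual, not_subset, mem_inter_iff, SetLike.mem_coe, and_assoc]

theorem apply_lt_apply_of_residual_lt (h : residual P A B x < residual P A B z) : A x < A z := by
  obtain ⟨y, hyz, hyx⟩ := apply_lt_apply_iff.1 h
  obtain ⟨p, hpP, hpy, hpx⟩ := notMem_residual.1 hyx
  exact apply_lt_apply_iff.2 ⟨p, hyz ⟨hpP, hpy⟩, hpx⟩

theorem Jumps.exists_of_residual {n : ℕ} (h : Jumps (residual P A B) (n + 1) x z) :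
    ∃ a b, Jumps B n a b ∧ a ∉ residual P A B x ∧ b ∈ residual P A B z := by
  induction n generalizing z with
  | zero =>
    obtain ⟨w, hxw, hwz⟩ := h
    obtain ⟨a, haz, haw⟩ := apply_lt_apply_iff.1 hwz
    exact ⟨a, a, le_refl a, fun hax => haw ((residual P A B).monotone hxw hax), haz⟩
  | succ n ih =>
    obtain ⟨w, hxw, hwz⟩ := h
    obtain ⟨a, b, hab, hax, hbw⟩ := ih hxw
    obtain ⟨c, hcz, hcw⟩ := apply_lt_apply_iff.1 hwz
    obtain ⟨p, hpP, hpc, hpw⟩ := notMem_residual.1 hcw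
    exact ⟨a, c, ⟨b, hab, apply_lt_apply_iff.2 ⟨p, hpc, fun hpb => hpw (hbw ⟨hpP, hpb⟩)⟩⟩, hax, hcz⟩

theorem notMem_residual_of_jumps {k l : ℕ} (hA : ∀ x z, Jumps A k x z → z ∉ A x)
    (hB : ∀ x z, Jumps B l x z → x ∈ B z) (h : Jumps (residual P A B) (l + 1 + 1 + k) x z) :
    z ∉ residual P A B x := by
  obtain ⟨w', ⟨w, hxw, hww'⟩, hw'z⟩ := h.exists_of_add
  obtain ⟨a, b, hab, hax, hbw⟩ := hxw.exists_of_residual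
  obtain ⟨c, hcw', hcw⟩ := apply_lt_apply_iff.1 hww'
  obtain ⟨p, hpP, hpc, hpw⟩ := notMem_residual.1 hcw
  have hap : a < p := lt_of_mem_of_notMem (hB a b hab) fun hpb => hpw (hbw ⟨hpP, hpb⟩)
  have hpz : p < z := lt_of_mem_of_notMem (hcw' ⟨hpP, hpc⟩)
    (hA w' z (hw'z.map fun _ _ => apply_lt_apply_of_residual_lt))
  exact fun hzx => hax ((residual P A B x).lower (hap.trans hpz).le hzx)

theorem mem_residual_of_jumps {k l : ℕ} (hA : ∀ x z, Jumps A k x z → x ∈ A z)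
    (hB : ∀ x z, Jumps B l x z → z ∉ B x) (h : Jumps (residual P A B) (k + (l + 1)) x z) :
    x ∈ residual P A B z := by
  obtain ⟨w, hxw, hwz⟩ := h.exists_of_add
  obtain ⟨a, b, hab, haw, hbz⟩ := hwz.exists_of_residual
  obtain ⟨p, -, hpa, hpw⟩ := notMem_residual.1 haw
  have hxp : x < p := lt_of_mem_of_notMem
    (hA x w (hxw.map fun _ _ => apply_lt_apply_of_residual_lt)) hpw
  have hpb : p < b := lt_of_mem_of_notMem hpa (hB a b hab)
  exact (residual P A B z).lower (hxp.trans hpb).le hbz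

protected theorem IsLocal.residual (hA : IsLocal A) (hB : IsLocal B) :
    IsLocal (residual P A B) := by
  obtain ⟨k, hk⟩ := hA
  obtain ⟨l, hl⟩ := hB
  refine ⟨l + 1 + 1 + k, fun x z h => ⟨?_, ?_⟩⟩
  · exact notMem_residual_of_jumps (fun x z h => (hk x z h).1) (fun x z h => (hl x z h).2) h
  · exact mem_residual_of_jumps (fun x z h => (hk x z h).2) (fun x z h => (hl x z h).1)
      (h.of_le (residual P A B).monotone (by omega))

end Residual

/-- The order relation as a monotone relation. -/
def iic : M →o LowerSet M where
  toFun := LowerSet.Iic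
  monotone' _ _ hle _ hz := le_trans hz hle

theorem mem_iic {x z : M} : z ∈ iic x ↔ z ≤ x := Iff.rfl

theorem isLocal_top : IsLocal (⊤ : M →o LowerSet M) :=
  ⟨1, fun _ _ ⟨_, _, h⟩ => absurd h (lt_irrefl _)⟩

theorem isLocal_bot : IsLocal (⊥ : M →o LowerSet M) :=
  ⟨1, fun _ _ ⟨_, _, h⟩ => absurd h (lt_irrefl _)⟩

theorem isLocal_iic : IsLocal (iic : M →o LowerSet M) :=
  ⟨1, fun _ _ h => ⟨(h.lt iic.monotone).not_ge, (h.lt iic.monotone).le⟩⟩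

/-- The relation `z ≤ [x]_r`: some element of the `r`-class of `x` is at least `z`. -/
def classHull {r : M → M → Prop} (hr : IsConvexEquiv r) : M →o LowerSet M where
  toFun x := lowerClosure {a | r x a}
  monotone' x y hxy := by
    refine lowerClosure_le.2 fun a ha => ?_
    rcases le_total a y with hay | hya
    · exact ⟨y, hr.equivalence.refl y, hay⟩
    · have hy : r x y := (hr.convex x).out (hr.equivalence.refl x) ha ⟨hxy, hya⟩
      exact ⟨a, hr.equivalence.trans (hr.equivalence.symm hy) ha, le_rfl⟩

section ClassHull

variable {r : M → M → Prop} (hr : IsConvexEquiv r) {x z : M}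

theorem rel_of_mem_classHull (hxz : x ≤ z) (h : z ∈ classHull hr x) : r x z := by
  obtain ⟨a, ha, hza⟩ := h
  exact (hr.convex x).out (hr.equivalence.refl x) ha ⟨hxz, hza⟩

theorem mem_classHull_of_le (h : z ≤ x) : z ∈ classHull hr x :=
  ⟨x, hr.equivalence.refl x, h⟩

theorem rel_iff_mem_classHull : r x z ↔ z ∈ classHull hr x ∧ x ∈ classHull hr z := by
  refine ⟨fun h => ⟨⟨z, h, le_rfl⟩, x, hr.equivalence.symm h, le_rfl⟩, fun ⟨hz, hx⟩ => ?_⟩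
  rcases le_total x z with hxz | hzx
  · exact rel_of_mem_classHull hr hxz hz
  · exact hr.equivalence.symm (rel_of_mem_classHull hr hzx hx)

theorem isLocal_classHull : IsLocal (classHull hr) := by
  refine ⟨1, fun x z h => ?_⟩
  have hxz : x < z := h.lt (classHull hr).monotone
  refine ⟨fun hz => ?_, mem_classHull_of_le hr hxz.le⟩
  obtain ⟨w, hxw, hwz⟩ := h
  obtain ⟨c, ⟨a, hza, hca⟩, hcw⟩ := apply_lt_apply_iff.1 hwz
  have hxa : r x a := hr.equivalence.trans (rel_of_mem_classHull hr hxz.le hz) hza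
  exact hcw ((classHull hr).monotone hxw ⟨a, hxa, hca⟩)

end ClassHull

theorem Jumps.of_sup_iic {A : M →o LowerSet M} {n : ℕ} {x w z : M} (hz : z ∈ A x)
    (h : Jumps (⇑(A ⊔ iic)) n x w) (hwz : w ≤ z) : Jumps A n x w := by
  have hsup : ∀ {y}, x ≤ y → y ≤ z → (A ⊔ iic) y = A y := fun {y} hxy hyz =>
    sup_eq_left.2 (LowerSet.Iic_le.2 ((A y).lower hyz (A.monotone hxy hz)))
  induction n generalizing w with
  | zero => exact h
  | succ n ih =>
    obtain ⟨u, hxu, huw⟩ := h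
    have hle : u ≤ w := ((A ⊔ iic).monotone.reflect_lt huw).le
    have hxu' : x ≤ u := hxu.le (A ⊔ iic).monotone
    rw [hsup hxu' (hle.trans hwz), hsup (hxu'.trans hle) hwz] at huw
    exact ⟨u, ih hxu (hle.trans hwz), huw⟩

theorem IsLocal.sup_iic {A : M →o LowerSet M} (hA : IsLocal A) : IsLocal (A ⊔ iic) := by
  obtain ⟨N, hN⟩ := hA
  refine ⟨N + 1, fun x z h => ?_⟩
  have hxz : x < z := h.lt (A ⊔ iic).monotone
  refine ⟨fun hz => ?_, Or.inr hxz.le⟩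
  have hzA : z ∈ A x := hz.resolve_right hxz.not_ge
  exact (hN x z ((h.of_sup_iic hzA le_rfl).of_succ A.monotone)).1 hzA

end LocalRelations

section SuccessorClasses

variable {M : Type*} [LinearOrder M] {r : M → M → Prop} {n : ℕ} {x y z : M}

theorem isConvexEquiv_ker {α : Type*} [PartialOrder α] {G : M → α} (hG : Monotone G) :
    IsConvexEquiv fun x y => G x = G y where
  equivalence := eq_equivalence.comap G
  convex _ := ⟨fun _ hy _ hz _ hw =>
    le_antisymm (hy.trans_le (hG hw.1)) ((hG hw.2).trans_eq (Eq.symm hz))⟩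

theorem succClassNat_of_jumps {α : Type*} [PartialOrder α] {G : M → α} (hG : Monotone G)
    (h : Jumps G n x z) (h' : ¬ Jumps G (n + 1) x z) :
    SuccClassNat (fun a b => G a = G b) n x z := by
  have eq_of_not_lt {a b : M} (hab : a ≤ b) (hlt : ¬ G a < G b) : G a = G b :=
    (hG hab).eq_of_not_lt hlt
  induction n generalizing z with
  | zero => exact eq_of_not_lt h fun hlt => h' ⟨x, le_refl x, hlt⟩
  | succ n ih =>
    obtain ⟨w, hw, hwz⟩ := h
    refine ⟨w, ih hw fun hw' => h' ⟨w, hw', hwz⟩, hG.reflect_lt hwz, hwz.ne, fun u hwu huz => ?_⟩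
    by_contra! hu
    exact h' ⟨u, ⟨w, hw, (hG hwu.le).lt_of_ne hu.1⟩, (hG huz.le).lt_of_ne hu.2⟩

theorem succClass_natCast : SuccClass r n x y ↔ SuccClassNat r n x y := by
  simp [SuccClass]

/-- The class of `z` is the last `r`-class meeting `S`, and it is the `n`-th successor of the class
of `x`. -/
def IsLastClass (r : M → M → Prop) (n : ℕ) (S : Set M) (x z : M) : Prop :=
  SuccClassNat r n x z ∧ z ∈ S ∧ ∀ w ∈ S, z < w → r z w

theorem exists_isLastClass_of_jumps_le {α : Type*} [PartialOrder α] {G : M → α} (hG : Monotone G)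
    {S : Set M} {m : ℕ} (hx : x ∈ S) (hm : ∀ z ∈ S, ¬ Jumps G m x z) :
    ∃ n < m, ∃ z, IsLastClass (fun a b => G a = G b) n S x z := by
  induction m with
  | zero => exact absurd (le_refl x) (hm x hx)
  | succ m ih =>
    by_cases h : ∃ z ∈ S, Jumps G m x z
    · obtain ⟨z, hz, hxz⟩ := h
      refine ⟨m, m.lt_succ_self, z, succClassNat_of_jumps hG hxz (hm z hz), hz, fun w hw hzw => ?_⟩
      exact (hG hzw.le).eq_of_not_lt fun hlt => hm w hw ⟨z, hxz, hlt⟩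
    · obtain ⟨n, hn, z, hz⟩ := ih fun z hz hxz => h ⟨z, hz, hxz⟩
      exact ⟨n, hn.trans m.lt_succ_self, z, hz⟩

theorem IsLastClass.mem_iff_leSucc {S : LowerSet M} (hr : IsConvexEquiv r)
    (hS : ∀ a ∈ S, ∀ b, r a b → b ∈ S) (h : IsLastClass r n S x z) : y ∈ S ↔ LeSucc r n y x := by
  obtain ⟨hxz, hzS, hlast⟩ := h
  simp only [LeSucc, LtSucc, succClass_natCast]
  refine ⟨fun hy => ?_, ?_⟩
  · by_cases hzy : r z y
    · exact Or.inr (hr.succClassNat_of_rel hxz hzy)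
    · have hyz : y < z := (lt_or_eq_of_le (not_lt.1 fun hlt => hzy (hlast y hy hlt))).resolve_right
        fun heq => hzy (heq ▸ hr.equivalence.refl z)
      have hyz' : ¬ r y z := fun hyz => hzy (hr.equivalence.symm hyz)
      exact Or.inl ⟨⟨z, hxz⟩, fun u hu => hr.lt_of_lt_of_not_rel hyz hyz'
        (hr.rel_of_succClassNat hxz hu)⟩
  · rintro (⟨-, hlt⟩ | hy)
    · exact S.lower (hlt z hxz).le hzS
    · exact hS z hzS y (hr.rel_of_succClassNat hxz hy)

/-- The kernel of a monotone relation `F`: the points `x` and `y` are equivalent when they are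
related by `F` to the same points on either side. -/
def kernelRel (F : M →o LowerSet M) (x y : M) : Prop :=
  F.prod (dual F) x = F.prod (dual F) y

variable {F : M →o LowerSet M}

theorem kernelRel_iff : kernelRel F x y ↔ (∀ w, w ∈ F x ↔ w ∈ F y) ∧ ∀ c, x ∈ F c ↔ y ∈ F c := by
  simp only [kernelRel, OrderHom.prod_coe, Prod.mk.injEq, LowerSet.ext_iff, Set.ext_iff,
    SetLike.mem_coe, mem_dual, not_iff_not]

theorem isConvexEquiv_kernelRel : IsConvexEquiv (kernelRel F) :=
  isConvexEquiv_ker (F.prod (dual F)).monotone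

theorem IsLocal.exists_not_jumps_of_mem (hF : IsLocal F) :
    ∃ m, ∀ x, ∀ z ∈ F x, ¬ Jumps (F.prod (dual F)) m x z := by
  obtain ⟨N, hN⟩ := hF
  obtain ⟨N', hN'⟩ := IsLocal.dual ⟨N, hN⟩
  refine ⟨N + N', fun x z hz h => ?_⟩
  obtain ⟨k, l, hkl, hk, hl⟩ := h.exists_add_eq_of_prod
  rcases le_total N k with hle | hle
  · exact (hN x z (hk.of_le F.monotone hle)).1 hz
  · exact (hN' x z (hl.of_le (dual F).monotone (by omega))).2 hz

theorem IsLocal.exists_mem_iff_leSucc (hF : IsLocal F) (hrefl : ∀ x, x ∈ F x) :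
    ∃ m, ∀ x y, y ∈ F x ↔
      ∃ n < m, (∃ z, IsLastClass (kernelRel F) n (F x) x z) ∧ LeSucc (kernelRel F) n y x := by
  obtain ⟨m, hm⟩ := hF.exists_not_jumps_of_mem
  have mem_iff {n : ℕ} {x y z : M} (h : IsLastClass (kernelRel F) n (F x) x z) :
      y ∈ F x ↔ LeSucc (kernelRel F) n y x :=
    h.mem_iff_leSucc isConvexEquiv_kernelRel fun a ha b hab => ((kernelRel_iff.1 hab).2 x).1 ha
  refine ⟨m, fun x y => ⟨fun hy => ?_, ?_⟩⟩
  · obtain ⟨n, hn, z, hz⟩ :=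
      exists_isLastClass_of_jumps_le (F.prod (dual F)).monotone (hrefl x) (hm x)
    exact ⟨n, hn, ⟨z, hz⟩, (mem_iff hz).1 hy⟩
  · rintro ⟨n, -, ⟨z, hz⟩, hle⟩
    exact (mem_iff hz).2 hle

end SuccessorClasses

section Definability

variable {L : Language} {M : Type*} [L.Structure M] {ι : Type*} {C : Set M}

theorem definable_exists [Finite ι] {q : (ι → M) → M → Prop}
    (hq : C.Definable L {w : Option ι → M | q (w ∘ some) (w none)}) :
    C.Definable L {v | ∃ z, q v z} := by
  convert hq.image_comp (some : ι → Option ι) using 1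
  ext v
  refine ⟨fun ⟨z, hz⟩ => ⟨fun o => o.elim z v, hz, rfl⟩, ?_⟩
  rintro ⟨w, hw, rfl⟩
  exact ⟨w none, hw⟩

theorem definable_mem {P : Set M} (hP : C.Definable₁ L P) (i : ι) :
    C.Definable L {v : ι → M | v i ∈ P} :=
  hP.preimage_comp fun _ => i

theorem definable_rel {r : M → M → Prop} (hr : C.Definable₂ L {p : M × M | r p.1 p.2})
    (i j : ι) : C.Definable L {v : ι → M | r (v i) (v j)} :=
  hr.preimage_comp ![i, j]

theorem definable₁_relMap (R : L.Relations 1) :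
    (∅ : Set M).Definable₁ L {x | Language.Structure.RelMap R ![x]} :=
  Set.empty_definable_iff.2 ⟨R.formula₁ (.var 0), Set.ext fun _ => by
    simp [Set.mem_ofPred_eq, Language.Formula.realize_rel₁]⟩

theorem definable₂_relMap (R : L.Relations 2) :
    (∅ : Set M).Definable₂ L {p : M × M | Language.Structure.RelMap R ![p.1, p.2]} :=
  Set.empty_definable_iff.2 ⟨R.formula₂ (.var 0) (.var 1), Set.ext fun _ => by
    simp [Set.mem_ofPred_eq, Language.Formula.realize_rel₂]⟩

end Definability

section DefinableLocal

variable (L : Language) {M : Type*} [L.Structure M] [LinearOrder M]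

/-- The building blocks of the elimination: monotone relations that are local and definable without
parameters. -/
structure IsDefinableLocal (A : M →o LowerSet M) : Prop where
  definable : (∅ : Set M).Definable₂ L {p : M × M | p.2 ∈ A p.1}
  isLocal : IsLocal A

namespace IsDefinableLocal

variable {L} {A B : M →o LowerSet M} {P : Set M}

theorem definable_mem_apply {ι : Type*} (hA : IsDefinableLocal L A) (i j : ι) :
    (∅ : Set M).Definable L {v : ι → M | v j ∈ A (v i)} :=
  definable_rel (r := fun x z => z ∈ A x) hA.definable i j

theorem top : IsDefinableLocal L (⊤ : M →o LowerSet M) :=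
  ⟨Set.definable_univ, isLocal_top⟩

theorem bot : IsDefinableLocal L (⊥ : M →o LowerSet M) :=
  ⟨Set.definable_empty, isLocal_bot⟩

protected theorem dual (hA : IsDefinableLocal L A) : IsDefinableLocal L (dual A) :=
  ⟨(hA.definable_mem_apply (1 : Fin 2) 0).compl, hA.isLocal.dual⟩

protected theorem residual (hP : (∅ : Set M).Definable₁ L P) (hA : IsDefinableLocal L A)
    (hB : IsDefinableLocal L B) : IsDefinableLocal L (residual P A B) where
  definable := by
    have hex : (∅ : Set M).Definable₂ L {p : M × M | ∃ z ∈ P, z ∈ B p.2 ∧ z ∉ A p.1} :=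
      definable_exists ((definable_mem hP none).inter
        ((hB.definable_mem_apply (some (1 : Fin 2)) none).inter
          (hA.definable_mem_apply (some 0) none).compl))
    simpa only [Set.Definable₂, Set.compl_ofPred, Set.mem_ofPred_eq, ← notMem_residual, not_not]
      using hex.compl
  isLocal := hA.isLocal.residual hB.isLocal

theorem sup_iic (hle : IsDefinableLocal L (iic : M →o LowerSet M)) (hA : IsDefinableLocal L A) :
    IsDefinableLocal L (A ⊔ iic) :=
  ⟨hA.definable.union hle.definable, hA.isLocal.sup_iic⟩

protected theorem classHull (hle : IsDefinableLocal L (iic : M →o LowerSet M)) {r : M → M → Prop}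
    (hr : IsConvexEquiv r) (hr' : (∅ : Set M).Definable₂ L {p : M × M | r p.1 p.2}) :
    IsDefinableLocal L (classHull hr) where
  definable := definable_exists ((definable_rel hr' (some (0 : Fin 2)) none).inter
    (hle.definable_mem_apply none (some 1)))
  isLocal := isLocal_classHull hr

end IsDefinableLocal

end DefinableLocal

section BooleanCombinations

variable (L : Language) {M : Type*} [L.Structure M] [LinearOrder M] {ι κ : Type*}

/-- The boolean combinations of the conditions `v i ∈ P` and `v j ∈ A (v i)` on tuples `v`, for
definable sets `P` and definable local relations `A`. Negation is derivable because both kinds of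
conditions are closed under complement. -/
inductive BoolComb : ((ι → M) → Prop) → Prop
  | const (p : Prop) : BoolComb fun _ => p
  | mem {P : Set M} (hP : (∅ : Set M).Definable₁ L P) (i : ι) : BoolComb fun v => v i ∈ P
  | rel {A : M →o LowerSet M} (hA : IsDefinableLocal L A) (i j : ι) :
      BoolComb fun v => v j ∈ A (v i)
  | and {q r : (ι → M) → Prop} (hq : BoolComb q) (hr : BoolComb r) : BoolComb fun v => q v ∧ r v
  | or {q r : (ι → M) → Prop} (hq : BoolComb q) (hr : BoolComb r) : BoolComb fun v => q v ∨ r v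

namespace BoolComb

variable {L} {q r : (ι → M) → Prop}

theorem not (hq : BoolComb L q) : BoolComb L fun v => ¬ q v := by
  induction hq with
  | const p => exact const _
  | @mem P hP i => exact mem (P := Pᶜ) (Set.Definable.compl hP) i
  | rel hA i j => exact rel hA.dual j i
  | and _ _ ihq ihr => simpa only [not_and_or] using ihq.or ihr
  | or _ _ ihq ihr => simpa only [not_or] using ihq.and ihr

theorem imp (hq : BoolComb L q) (hr : BoolComb L r) : BoolComb L fun v => q v → r v := by
  simpa only [imp_iff_not_or] using hq.not.or hr

theorem iff (hq : BoolComb L q) (hr : BoolComb L r) : BoolComb L fun v => q v ↔ r v := by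
  simpa only [iff_iff_implies_and_implies] using (hq.imp hr).and (hr.imp hq)

theorem forall_mem {σ : Type*} {s : Set σ} (hs : s.Finite) {q : σ → (ι → M) → Prop}
    (hq : ∀ a ∈ s, BoolComb L (q a)) : BoolComb L fun v => ∀ a ∈ s, q a v := by
  induction s, hs using Set.Finite.induction_on with
  | empty => simpa only [mem_empty_iff_false, false_imp_iff, implies_true] using const True
  | insert _ _ ih =>
    simpa only [forall_mem_insert] using (hq _ (mem_insert _ _)).and
      (ih fun a ha => hq a (mem_insert_of_mem _ ha))

theorem reindex (hq : BoolComb L q) (f : ι → κ) : BoolComb L fun v : κ → M => q (v ∘ f) := by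
  induction hq with
  | const p => exact const p
  | mem hP i => exact mem hP (f i)
  | rel hA i j => exact rel hA (f i) (f j)
  | and _ _ ihq ihr => exact ihq.and ihr
  | or _ _ ihq ihr => exact ihq.or ihr

theorem definable (hq : BoolComb L q) : (∅ : Set M).Definable L {v | q v} := by
  induction hq with
  | const p => by_cases hp : p <;> simp [hp, Set.definable_univ, Set.definable_empty]
  | mem hP i => exact definable_mem hP i
  | rel hA i j => exact hA.definable_mem_apply i j
  | and _ _ ihq ihr => exact ihq.inter ihr
  | or _ _ ihq ihr => exact ihq.union ihr

end BoolComb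

/-- The segments `A (v i)` depending on a tuple `v`, for definable local relations `A`. -/
def IsSegment (S : (ι → M) → LowerSet M) : Prop :=
  ∃ A, IsDefinableLocal L A ∧ ∃ i, S = fun v => A (v i)

/-- The conditions on a point `z` depending on a tuple `v` that require `z` to lie in a fixed
definable set, in finitely many segments and outside finitely many others, subject to a side
condition on `v`. -/
def IsCell (Q : (ι → M) → M → Prop) : Prop :=
  ∃ (q : (ι → M) → Prop) (P : Set M) (U W : Set ((ι → M) → LowerSet M)),
    BoolComb L q ∧ (∅ : Set M).Definable₁ L P ∧
    (U.Finite ∧ ∀ S ∈ U, IsSegment L S) ∧ (W.Finite ∧ ∀ S ∈ W, IsSegment L S) ∧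
    Q = fun v z => q v ∧ z ∈ P ∧ (∀ S ∈ U, z ∈ S v) ∧ ∀ S ∈ W, z ∉ S v

/-- The finite disjunctions of cells. -/
inductive IsCellUnion : ((ι → M) → M → Prop) → Prop
  | cell {Q : (ι → M) → M → Prop} (hQ : IsCell L Q) : IsCellUnion Q
  | or {Q R : (ι → M) → M → Prop} (hQ : IsCellUnion Q) (hR : IsCellUnion R) :
      IsCellUnion fun v z => Q v z ∨ R v z

variable {L}

theorem isCell_of_boolComb {q : (ι → M) → Prop} (hq : BoolComb L q) :
    IsCell L fun v _ => q v :=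
  ⟨q, univ, ∅, ∅, hq, Set.definable_univ, by simp, by simp, by simp⟩

theorem isCell_mem {P : Set M} (hP : (∅ : Set M).Definable₁ L P) :
    IsCell L fun (_ : ι → M) z => z ∈ P :=
  ⟨fun _ => True, P, ∅, ∅, .const True, hP, by simp, by simp, by simp⟩

theorem IsSegment.isCell_mem {S : (ι → M) → LowerSet M} (hS : IsSegment L S) :
    IsCell L fun v z => z ∈ S v :=
  ⟨fun _ => True, univ, {S}, ∅, .const True, Set.definable_univ, by simpa, by simp, by simp⟩

theorem IsSegment.isCell_notMem {S : (ι → M) → LowerSet M} (hS : IsSegment L S) :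
    IsCell L fun v z => z ∉ S v :=
  ⟨fun _ => True, univ, ∅, {S}, .const True, Set.definable_univ, by simp, by simpa, by simp⟩

theorem IsCell.and {Q R : (ι → M) → M → Prop} (hQ : IsCell L Q) (hR : IsCell L R) :
    IsCell L fun v z => Q v z ∧ R v z := by
  obtain ⟨q, P, U, W, hq, hP, ⟨hU, hU'⟩, ⟨hW, hW'⟩, rfl⟩ := hQ
  obtain ⟨q₁, P₁, U₁, W₁, hq₁, hP₁, ⟨hU₁, hU₁'⟩, ⟨hW₁, hW₁'⟩, rfl⟩ := hR
  refine ⟨_, P ∩ P₁, U ∪ U₁, W ∪ W₁, hq.and hq₁, hP.inter hP₁,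
    ⟨hU.union hU₁, fun S hS => hS.elim (hU' S) (hU₁' S)⟩,
    ⟨hW.union hW₁, fun S hS => hS.elim (hW' S) (hW₁' S)⟩, ?_⟩
  ext v z
  simp only [mem_inter_iff, mem_union, or_imp, forall_and]
  tauto

theorem IsCellUnion.and {Q R : (ι → M) → M → Prop} (hQ : IsCellUnion L Q)
    (hR : IsCellUnion L R) : IsCellUnion L fun v z => Q v z ∧ R v z := by
  induction hQ with
  | cell hQ =>
    induction hR with
    | cell hR => exact .cell (hQ.and hR)
    | or _ _ ih ih' => simpa only [and_or_left] using ih.or ih'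
  | or _ _ ih ih' => simpa only [or_and_right] using ih.or ih'

theorem BoolComb.isCellUnion {q : (Option ι → M) → Prop} (hq : BoolComb L q) :
    IsCellUnion L fun (v : ι → M) z => q fun o => o.elim z v := by
  induction hq with
  | const p => exact .cell (isCell_of_boolComb (.const p))
  | mem hP i =>
    cases i with
    | none => exact .cell (isCell_mem hP)
    | some i => exact .cell (isCell_of_boolComb (.mem hP i))
  | @rel A hA i j =>
    cases i with
    | none =>
      cases j with
      | none => exact .cell (isCell_mem (P := {z | z ∈ A z}) (hA.definable_mem_apply (0 : Fin 1) 0))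
      | some j =>
        have hcell := IsSegment.isCell_notMem ⟨_, hA.dual, j, rfl⟩
        simp only [mem_dual, not_not] at hcell
        exact .cell hcell
    | some i =>
      cases j with
      | none => exact .cell (IsSegment.isCell_mem ⟨_, hA, i, rfl⟩)
      | some j => exact .cell (isCell_of_boolComb (.rel hA i j))
  | and _ _ ihq ihr => exact ihq.and ihr
  | or _ _ ihq ihr => exact ihq.or ihr

theorem exists_mem_lowerSets_iff {σ : Type*} {f : σ → LowerSet M} {P : Set M} {U W : Set σ}
    (hU : U.Finite) (hU' : U.Nonempty) (hW : W.Finite) (hW' : W.Nonempty) :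
    (∃ z ∈ P, (∀ S ∈ U, z ∈ f S) ∧ ∀ S ∈ W, z ∉ f S) ↔
      ∀ S ∈ U, ∀ T ∈ W, ¬ P ∩ f S ⊆ f T := by
  refine ⟨fun ⟨z, hzP, hzU, hzW⟩ S hS T hT h => hzW T hT (h ⟨hzP, hzU S hS⟩), fun h => ?_⟩
  -- Lower sets form a chain, so the tightest constraint on either side implies the others.
  obtain ⟨S, hS, hSmin⟩ := Set.exists_min_image U f hU hU'
  obtain ⟨T, hT, hTmax⟩ := Set.exists_max_image W f hW hW'
  obtain ⟨z, ⟨hzP, hzS⟩, hzT⟩ := not_subset.1 (h S hS T hT)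
  exact ⟨z, hzP, fun S' hS' => hSmin S' hS' hzS, fun T' hT' hzT' => hzT (hTmax T' hT' hzT')⟩

theorem IsSegment.boolComb_inter_subset {P : Set M} {S T : (ι → M) → LowerSet M}
    (hP : (∅ : Set M).Definable₁ L P) (hS : IsSegment L S) (hT : IsSegment L T) :
    BoolComb L fun v => P ∩ S v ⊆ T v := by
  obtain ⟨A, hA, i, rfl⟩ := hS
  obtain ⟨B, hB, j, rfl⟩ := hT
  exact .rel (.residual hP hB hA) j i

theorem IsCell.exists [Nonempty ι] {Q : (ι → M) → M → Prop} (hQ : IsCell L Q) :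
    BoolComb L fun v => ∃ z, Q v z := by
  obtain ⟨q, P, U, W, hq, hP, ⟨hU, hU'⟩, ⟨hW, hW'⟩, rfl⟩ := hQ
  obtain ⟨i⟩ := ‹Nonempty ι›
  have hU'' : ∀ S ∈ insert (fun v => (⊤ : M →o LowerSet M) (v i)) U, IsSegment L S :=
    forall_mem_insert.2 ⟨⟨⊤, .top, i, rfl⟩, hU'⟩
  have hW'' : ∀ S ∈ insert (fun v => (⊥ : M →o LowerSet M) (v i)) W, IsSegment L S :=
    forall_mem_insert.2 ⟨⟨⊥, .bot, i, rfl⟩, hW'⟩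
  have hex (v : ι → M) : (∃ z ∈ P, (∀ S ∈ U, z ∈ S v) ∧ ∀ S ∈ W, z ∉ S v) ↔
      ∀ S ∈ insert (fun v => (⊤ : M →o LowerSet M) (v i)) U,
        ∀ T ∈ insert (fun v => (⊥ : M →o LowerSet M) (v i)) W, ¬ P ∩ S v ⊆ T v := by
    rw [← exists_mem_lowerSets_iff (f := fun S => S v) (hU.insert _) (insert_nonempty _ _)
      (hW.insert _) (insert_nonempty _ _)]
    simp
  simp only [exists_and_left, hex]
  exact hq.and (BoolComb.forall_mem (hU.insert _) fun S hS =>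
    BoolComb.forall_mem (hW.insert _) fun T hT =>
      ((hU'' S hS).boolComb_inter_subset hP (hW'' T hT)).not)

theorem IsCellUnion.exists [Nonempty ι] {Q : (ι → M) → M → Prop} (hQ : IsCellUnion L Q) :
    BoolComb L fun v => ∃ z, Q v z := by
  induction hQ with
  | cell hQ => exact hQ.exists
  | or _ _ ih ih' => simpa only [exists_or] using ih.or ih'

theorem BoolComb.exists {Q : (ι → M) → M → Prop}
    (hQ : BoolComb L fun w : Option ι → M => Q (w ∘ some) (w none)) :
    BoolComb L fun v => ∃ z, Q v z := by
  cases isEmpty_or_nonempty ι with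
  | inl _ =>
    convert BoolComb.const (∃ z, Q isEmptyElim z) using 1
    ext v
    rw [Subsingleton.elim v isEmptyElim]
  | inr _ => exact hQ.isCellUnion.exists

theorem BoolComb.forall {Q : (ι → M) → M → Prop}
    (hQ : BoolComb L fun w : Option ι → M => Q (w ∘ some) (w none)) :
    BoolComb L fun v => ∀ z, Q v z := by
  simpa only [not_exists, not_not] using
    (BoolComb.exists (Q := fun v z => ¬ Q v z) hQ.not).not

namespace BoolComb

theorem app₂ {r : M → M → Prop} (hr : BoolComb L fun v : Fin 2 → M => r (v 0) (v 1)) (i j : ι) :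
    BoolComb L fun v => r (v i) (v j) :=
  hr.reindex ![i, j]

theorem lt (hle : IsDefinableLocal L (iic : M →o LowerSet M)) (i j : ι) :
    BoolComb L fun v : ι → M => v i < v j := by
  simpa only [mem_iic, not_le] using (rel hle i j).not

theorem eq (hle : IsDefinableLocal L (iic : M →o LowerSet M)) (i j : ι) :
    BoolComb L fun v : ι → M => v i = v j := by
  simpa only [mem_iic, le_antisymm_iff] using (rel hle j i).and (rel hle i j)

theorem of_relMap₂ {R : L.Relations 2}
    (hR : BoolComb L fun v : Fin 2 → M => Language.Structure.RelMap R ![v 0, v 1]) :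
    BoolComb L fun v : Fin 2 → M => Language.Structure.RelMap R v := by
  convert hR using 3 with v
  exact (FinVec.etaExpand_eq v).symm

theorem of_relMap₁ {R : L.Relations 1}
    (hR : BoolComb L fun v : Fin 1 → M => Language.Structure.RelMap R ![v 0]) :
    BoolComb L fun v : Fin 1 → M => Language.Structure.RelMap R v := by
  convert hR using 3 with v
  exact (FinVec.etaExpand_eq v).symm

theorem realize [L.IsRelational] (hle : IsDefinableLocal L (iic : M →o LowerSet M))
    (hR : ∀ n (R : L.Relations n), BoolComb L fun v : Fin n → M => Language.Structure.RelMap R v)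
    {n : ℕ} (φ : L.BoundedFormula ι n) :
    BoolComb L fun v : ι ⊕ Fin n → M => φ.Realize (v ∘ Sum.inl) (v ∘ Sum.inr) := by
  have exists_eq_var {n : ℕ} (t : L.Term (ι ⊕ Fin n)) : ∃ i, t = Language.Term.var i := by
    cases t with
    | var i => exact ⟨i, rfl⟩
    | func f _ => exact isEmptyElim f
  induction φ with
  | falsum => exact const False
  | equal t₁ t₂ =>
    obtain ⟨i, rfl⟩ := exists_eq_var t₁
    obtain ⟨j, rfl⟩ := exists_eq_var t₂
    simpa only [Language.BoundedFormula.Realize, Sum.elim_comp_inl_inr,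
      Language.Term.realize_var] using BoolComb.eq hle i j
  | rel R ts =>
    choose f hf using fun i => exists_eq_var (ts i)
    simp only [Language.BoundedFormula.Realize, Sum.elim_comp_inl_inr, hf,
      Language.Term.realize_var]
    exact (hR _ R).reindex f
  | imp _ _ ih ih' => exact ih.imp ih'
  | @all n φ ih =>
    let f : ι ⊕ Fin (n + 1) → Option (ι ⊕ Fin n) :=
      Sum.elim (some ∘ Sum.inl) (Fin.snoc (some ∘ Sum.inr) none)
    refine BoolComb.forall (Q := fun v z => φ.Realize (v ∘ Sum.inl) (Fin.snoc (v ∘ Sum.inr) z)) ?_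
    convert ih.reindex f using 3 with w
    · rfl
    · exact (Fin.comp_snoc w _ _).symm

end BoolComb

section Relations

variable (hle : IsDefinableLocal L (iic : M →o LowerSet M))

include hle

theorem boolComb_succClassNat {r : M → M → Prop}
    (hr : BoolComb L fun v : Fin 2 → M => r (v 0) (v 1)) (n : ℕ) :
    BoolComb L fun v : Fin 2 → M => SuccClassNat r n (v 0) (v 1) := by
  induction n with
  | zero => exact hr
  | succ n ih =>
    have hnext : BoolComb L fun v : Fin 2 → M => NextClass r (v 0) (v 1) :=
      (BoolComb.lt hle 0 1).and (hr.not.and (.forall ((BoolComb.lt hle _ _).imp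
        ((BoolComb.lt hle _ _).imp ((hr.app₂ _ _).or (hr.app₂ _ _))))))
    exact .exists ((ih.app₂ (some 0) none).and (hnext.app₂ none (some 1)))

theorem boolComb_succClass {r : M → M → Prop}
    (hr : BoolComb L fun v : Fin 2 → M => r (v 0) (v 1)) (n : ℤ) :
    BoolComb L fun v : Fin 2 → M => SuccClass r n (v 0) (v 1) := by
  unfold SuccClass
  split
  · exact boolComb_succClassNat hle hr _
  · exact (boolComb_succClassNat hle hr _).app₂ 1 0

theorem boolComb_ltSucc {r : M → M → Prop}
    (hr : BoolComb L fun v : Fin 2 → M => r (v 0) (v 1)) (n : ℤ) :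
    BoolComb L fun v : Fin 2 → M => LtSucc r n (v 0) (v 1) :=
  have hsucc := boolComb_succClass hle hr n
  .and (.exists (hsucc.app₂ (some 1) none))
    (.forall ((hsucc.app₂ (some 1) none).imp (BoolComb.lt hle (some 0) none)))

theorem boolComb_leSucc {r : M → M → Prop}
    (hr : BoolComb L fun v : Fin 2 → M => r (v 0) (v 1)) (n : ℤ) :
    BoolComb L fun v : Fin 2 → M => LeSucc r n (v 0) (v 1) :=
  (boolComb_ltSucc hle hr n).or ((boolComb_succClass hle hr n).app₂ 1 0)

theorem boolComb_rel_of_isConvexEquiv {r : M → M → Prop} (hr : IsConvexEquiv r)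
    (hr' : (∅ : Set M).Definable₂ L {p : M × M | r p.1 p.2}) :
    BoolComb L fun v : Fin 2 → M => r (v 0) (v 1) := by
  simpa only [rel_iff_mem_classHull hr] using
    BoolComb.and (.rel (.classHull hle hr hr') 0 1) (.rel (.classHull hle hr hr') 1 0)

end Relations

theorem boolComb_kernelRel {F : M →o LowerSet M} (hF : IsDefinableLocal L F) :
    BoolComb L fun v : Fin 2 → M => kernelRel F (v 0) (v 1) := by
  simp only [kernelRel_iff]
  exact .and (.forall (.iff (.rel hF (some 0) none) (.rel hF (some 1) none)))
    (.forall (.iff (.rel hF none (some 0)) (.rel hF none (some 1))))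

theorem boolComb_exists_isLastClass (hle : IsDefinableLocal L (iic : M →o LowerSet M))
    {r : M → M → Prop} (hr : BoolComb L fun v : Fin 2 → M => r (v 0) (v 1)) {F : M →o LowerSet M}
    (hF : IsDefinableLocal L F) (n : ℕ) :
    BoolComb L fun v : Fin 1 → M => ∃ z, IsLastClass r n (F (v 0)) (v 0) z :=
  .exists (.and ((boolComb_succClassNat hle hr n).app₂ (some 0) none)
    (.and (.rel hF (some 0) none) (.forall (.imp (.rel hF (some (some 0)) none)
      (.imp (BoolComb.lt hle (some none) none) (hr.app₂ (some none) none))))))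

end BooleanCombinations

section QuantifierFree

variable (L : Language) {M : Type*} [L.Structure M] {ι : Type*}

/-- A condition on tuples is quantifier-free definable when a quantifier-free formula without
parameters expresses it. -/
def IsQFDef (q : (ι → M) → Prop) : Prop :=
  ∃ φ : L.Formula ι, φ.IsQF ∧ ∀ v, φ.Realize v ↔ q v

namespace IsQFDef

variable {L} {q r : (ι → M) → Prop}

theorem const (p : Prop) : IsQFDef L fun _ : ι → M => p := by
  by_cases hp : p
  · exact ⟨⊤, Language.BoundedFormula.IsQF.top, fun _ => by simp [hp]⟩
  · exact ⟨⊥, Language.BoundedFormula.isQF_bot, fun _ => by simp [hp]⟩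

theorem not (hq : IsQFDef L q) : IsQFDef L fun v => ¬ q v := by
  obtain ⟨φ, hφ, hφq⟩ := hq
  exact ⟨φ.not, hφ.not, fun v => by rw [Language.Formula.realize_not, hφq]⟩

theorem and (hq : IsQFDef L q) (hr : IsQFDef L r) : IsQFDef L fun v => q v ∧ r v := by
  obtain ⟨φ, hφ, hφq⟩ := hq
  obtain ⟨ψ, hψ, hψr⟩ := hr
  exact ⟨φ ⊓ ψ, hφ.inf hψ, fun v => by rw [Language.Formula.realize_inf, hφq, hψr]⟩

theorem or (hq : IsQFDef L q) (hr : IsQFDef L r) : IsQFDef L fun v => q v ∨ r v := by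
  obtain ⟨φ, hφ, hφq⟩ := hq
  obtain ⟨ψ, hψ, hψr⟩ := hr
  exact ⟨φ ⊔ ψ, hφ.sup hψ, fun v => by rw [Language.Formula.realize_sup, hφq, hψr]⟩

theorem exists_lt {q : ℕ → (ι → M) → Prop} (hq : ∀ n, IsQFDef L (q n)) (m : ℕ) :
    IsQFDef L fun v => ∃ n < m, q n v := by
  induction m with
  | zero => simpa only [not_lt_zero, false_and, exists_false] using const False
  | succ m ih => simpa only [Nat.exists_lt_succ_right] using ih.or (hq m)

theorem relMap_unary (R : L.Relations 1) (i : ι) :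
    IsQFDef L fun v : ι → M => Language.Structure.RelMap R ![v i] :=
  ⟨R.formula₁ (.var i), (Language.BoundedFormula.IsAtomic.rel _ _).isQF, fun _ => by
    rw [Language.Formula.realize_rel₁]; rfl⟩

theorem relMap_binary (R : L.Relations 2) (i j : ι) :
    IsQFDef L fun v : ι → M => Language.Structure.RelMap R ![v i, v j] :=
  ⟨R.formula₂ (.var i) (.var j), (Language.BoundedFormula.IsAtomic.rel _ _).isQF, fun _ => by
    rw [Language.Formula.realize_rel₂]; rfl⟩

end IsQFDef

variable {L}

theorem completeTheory_iff_of_realize_iff [Finite ι] {φ ψ : L.Formula ι}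
    (h : ∀ v : ι → M, φ.Realize v ↔ ψ.Realize v) : (L.completeTheory M).Iff φ ψ := by
  have hM : M ⊨ (((φ.iff ψ).relabel (Sum.inr : ι → Empty ⊕ ι)).iAlls ι :
      L.Sentence) := by
    rw [Language.Sentence.Realize, Language.Formula.realize_iAlls]
    intro v
    rw [Language.Formula.realize_relabel, Language.Formula.realize_iff]
    exact h _
  intro N v xs
  have hN := (Language.realize_iff_of_model_completeTheory M N _).2 hM
  rw [Language.Sentence.Realize, Language.Formula.realize_iAlls] at hN
  have hv := hN v
  rw [Language.Formula.realize_relabel] at hv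
  rwa [Subsingleton.elim xs default]

end QuantifierFree

section NamedStructure

variable {I J M : Type*} [LinearOrder M] [(ccelSuccLanguage I J).Structure M] {ι : Type*}

instance : (ccelSuccLanguage I J).IsRelational := fun _ => inferInstanceAs (IsEmpty Empty)

variable (hM : IsNamedCcelSucc I J M)

include hM

theorem isDefinableLocal_iic :
    IsDefinableLocal (ccelSuccLanguage I J) (iic : M →o LowerSet M) where
  definable := by
    have hlt : (∅ : Set M).Definable₂ (ccelSuccLanguage I J)
        {p : M × M | ltInterp I J M p.1 p.2} :=
      definable₂_relMap (L := ccelSuccLanguage I J) CcelSuccRel.lt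
    simp only [hM.lt_iff] at hlt
    simpa only [Set.Definable₂, Set.compl_ofPred, Set.mem_ofPred_eq, mem_iic, not_lt]
      using hlt.compl
  isLocal := isLocal_iic

theorem boolComb_eInterp (k : J) :
    BoolComb (ccelSuccLanguage I J) fun v : Fin 2 → M => EInterp I M k (v 0) (v 1) :=
  boolComb_rel_of_isConvexEquiv (isDefinableLocal_iic hM) (hM.isConvexEquiv k)
    (definable₂_relMap (L := ccelSuccLanguage I J) (CcelSuccRel.E k))

theorem boolComb_rInterp (n : ℤ) (k : J) :
    BoolComb (ccelSuccLanguage I J) fun v : Fin 2 → M => RInterp I M n k (v 0) (v 1) := by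
  rcases lt_or_ge n 0 with hn | hn
  · simpa only [hM.R_neg n k hn] using
      boolComb_ltSucc (isDefinableLocal_iic hM) (boolComb_eInterp hM k) n
  · simpa only [hM.R_nonneg n k hn] using
      boolComb_leSucc (isDefinableLocal_iic hM) (boolComb_eInterp hM k) n

theorem boolComb_relMap (n : ℕ) (R : (ccelSuccLanguage I J).Relations n) :
    BoolComb (ccelSuccLanguage I J) fun v : Fin n → M => Language.Structure.RelMap R v := by
  cases R with
  | lt =>
    have hlt : BoolComb (ccelSuccLanguage I J) fun v : Fin 2 → M => ltInterp I J M (v 0) (v 1) := by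
      simpa only [hM.lt_iff] using BoolComb.lt (isDefinableLocal_iic hM) 0 1
    exact .of_relMap₂ hlt
  | P i =>
    exact .of_relMap₁ (.mem (definable₁_relMap (L := ccelSuccLanguage I J) (CcelSuccRel.P i)) 0)
  | E k => exact .of_relMap₂ (boolComb_eInterp hM k)
  | R m k => exact .of_relMap₂ (boolComb_rInterp hM m k)

theorem isQFDef_mem {P : Set M} (hP : (∅ : Set M).Definable₁ (ccelSuccLanguage I J) P) (i : ι) :
    IsQFDef (ccelSuccLanguage I J) fun v : ι → M => v i ∈ P := by
  obtain ⟨k, rfl⟩ := hM.named_unary P hP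
  exact .relMap_unary _ i

theorem isQFDef_lt (i j : ι) : IsQFDef (ccelSuccLanguage I J) fun v : ι → M => v i < v j := by
  have hlt := IsQFDef.relMap_binary (L := ccelSuccLanguage I J) (M := M) CcelSuccRel.lt i j
  simpa only [← ltInterp.eq_def, hM.lt_iff] using hlt

theorem isQFDef_leSucc {r : M → M → Prop} (hr : IsConvexEquiv r)
    (hr' : (∅ : Set M).Definable₂ (ccelSuccLanguage I J) {p : M × M | r p.1 p.2}) (n : ℕ)
    (i j : ι) : IsQFDef (ccelSuccLanguage I J) fun v : ι → M => LeSucc r n (v i) (v j) := by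
  obtain ⟨k, rfl⟩ := hM.named_convexEquiv r hr hr'
  simp only [← hM.R_nonneg n k n.cast_nonneg]
  exact .relMap_binary _ i j

theorem isQFDef_mem_of_reflexive {F : M →o LowerSet M}
    (hF : IsDefinableLocal (ccelSuccLanguage I J) F) (hrefl : ∀ x, x ∈ F x) (i j : ι) :
    IsQFDef (ccelSuccLanguage I J) fun v : ι → M => v j ∈ F (v i) := by
  obtain ⟨m, hm⟩ := hF.isLocal.exists_mem_iff_leSucc hrefl
  have hker := boolComb_kernelRel hF
  simp only [hm]
  refine .exists_lt (fun n => .and (isQFDef_mem hM (P := {x | ∃ z, IsLastClass _ n (F x) x z}) ?_ i)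
    (isQFDef_leSucc hM isConvexEquiv_kernelRel hker.definable n j i)) m
  exact (boolComb_exists_isLastClass (isDefinableLocal_iic hM) hker hF n).definable

theorem isQFDef_mem_apply {A : M →o LowerSet M} (hA : IsDefinableLocal (ccelSuccLanguage I J) A)
    (i j : ι) : IsQFDef (ccelSuccLanguage I J) fun v : ι → M => v j ∈ A (v i) := by
  have hsup {B : M →o LowerSet M} (hB : IsDefinableLocal (ccelSuccLanguage I J) B) (i j : ι) :
      IsQFDef (ccelSuccLanguage I J) fun v : ι → M => v j ∈ (B ⊔ iic) (v i) :=
    isQFDef_mem_of_reflexive hM ((isDefinableLocal_iic hM).sup_iic hB) (fun _ => Or.inr le_rfl) i j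
  have hlt := (isQFDef_lt hM i j).and (hsup hA i j)
  have hgt := (isQFDef_lt hM j i).and (hsup hA.dual j i).not
  have heq := ((isQFDef_lt hM i j).or (isQFDef_lt hM j i)).not.and
    (isQFDef_mem hM (P := {x | x ∈ A x}) (hA.definable_mem_apply (0 : Fin 1) 0) i)
  convert hlt.or (hgt.or heq) using 2 with v
  rcases lt_trichotomy (v i) (v j) with h | h | h
  · simp [mem_iic, h, h.not_gt, h.not_ge]
  · simp [h]
  · simp [mem_iic, h, h.not_gt, h.not_ge]

theorem BoolComb.isQFDef {q : (ι → M) → Prop} (hq : BoolComb (ccelSuccLanguage I J) q) :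
    IsQFDef (ccelSuccLanguage I J) q := by
  induction hq with
  | const p => exact .const p
  | mem hP i => exact isQFDef_mem hM hP i
  | rel hA i j => exact isQFDef_mem_apply hM hA i j
  | and _ _ ihq ihr => exact ihq.and ihr
  | or _ _ ihq ihr => exact ihq.or ihr

end NamedStructure

end CcelSucc

theorem mainTheorem4 {I J M : Type*} [LinearOrder M] [(ccelSuccLanguage I J).Structure M]
    (hM : IsNamedCcelSucc I J M) :
    EliminatesQuantifiers ((ccelSuccLanguage I J).completeTheory M) := by
  intro n φ
  have hφ : CcelSucc.BoolComb (ccelSuccLanguage I J) fun v : Fin n → M => φ.Realize v := by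
    convert (CcelSucc.BoolComb.realize (CcelSucc.isDefinableLocal_iic hM)
      (CcelSucc.boolComb_relMap hM) φ).reindex (Sum.elim id Fin.elim0) using 2 with v
    rw [Language.Formula.Realize]
    exact iff_of_eq (congrArg _ (Subsingleton.elim _ _))
  obtain ⟨ψ, hψ, hψφ⟩ := hφ.isQFDef hM
  exact ⟨ψ, hψ, CcelSucc.completeTheory_iff_of_realize_iff fun v => (hψφ v).symm⟩
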